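/- Let $(\Omega,\nu)$ be an atomless standard Borel probability space and let $W:\Omega^2\to[0,1]$ be a graphon, i.e. a symmetric measurable function, with edge density $e=\int_{\Omega^2} W\,d\nu^{\otimes 2}$. A fractional vertex cover of $W$ is a function $\mathfrak c\in L^\infty(\Omega)$ with $0\le\mathfrak c\le 1$ almost everywhere such that the set $\{W\neq 0\}\setminus\{(x,y):\mathfrak c(x)+\mathfrak c(y)\ge 1\}$ is $\nu^{\otimes 2}$-null; let $\tau(W)$ be the infimum of $\int_\Omega\mathfrak c\,d\nu$ over all fractional vertex covers $\mathfrak c$ of $W$. Two graphons $W,U$ on $\Omega$ are isomorphic if there is a measure-preserving bijection $\varphi:\Omega\to\Omega$ (measurable with measurable inverse) such that $W(x,y)=U(\varphi(x),\varphi(y))$ for almost all $(x,y)$. For a measurable partition $\Omega=B_1\sqcup B_2$ with $\nu(B_1)=1-\sqrt{1-e}$, $\nu(B_2)=\sqrt{1-e}$, let $\Psi_e$ be the graphon equal to $0$ on $B_2\times B_2$ and $1$ elsewhere. For a measurable partition $\Omega=C_1\sqcup C_2$ with $\nu(C_1)=\sqrt e$, $\nu(C_2)=1-\sqrt e$, let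 $\Phi_e$ be the graphon equal to $1$ on $C_1\times C_1$ and $0$ elsewhere. Such graphons exist. **Theorem.** We have $$\tau(W)\ \ge\ \min\Big\{\sqrt{\tfrac e4},\ 1-\sqrt{1-e}\Big\},$$ where the minimum equals $1-\sqrt{1-e}$ if $e\le 0.64$ and equals $\sqrt{e/4}$ if $e\ge 0.64$. Furthermore, for any choice of the partitions defining $\Psi_e$ and $\Phi_e$, equality $\tau(W)=\min\{\sqrt{e/4},1-\sqrt{1-e}\}$ holds if and only if $e\le 0.64$ and $W$ is isomorphic to $\Psi_e$, or $e\ge 0.64$ and $W$ is isomorphic to $\Phi_e$. -/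

import Mathlib

open MeasureTheory

/-- A graphon on `Ω`: a symmetric measurable function `Ω² → [0,1]`. -/
structure Graphon (Ω : Type*) [MeasurableSpace Ω] where
  toFun : Ω → Ω → ℝ
  measurable' : Measurable (Function.uncurry toFun)
  symm' : ∀ x y, toFun x y = toFun y x
  mem_Icc' : ∀ x y, toFun x y ∈ Set.Icc (0 : ℝ) 1

namespace Graphon

variable {Ω : Type*} [MeasurableSpace Ω]

instance : CoeFun (Graphon Ω) (fun _ => Ω → Ω → ℝ) := ⟨Graphon.toFun⟩

/-- The edge density `∫ W dν²`. -/
noncomputable def edgeDensity (W : Graphon Ω) (ν : Measure Ω) : ℝ :=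
  ∫ p : Ω × Ω, W p.1 p.2 ∂(ν.prod ν)

/-- `c ∈ L^∞(Ω)` is a fractional vertex cover of `W` if `0 ≤ c ≤ 1` almost everywhere and
the set `supp W \ {(x, y) : c x + c y ≥ 1}` is null. -/
structure IsFractionalVertexCover (W : Graphon Ω) (ν : Measure Ω) (c : Ω → ℝ) : Prop where
  memLp : MemLp c ⊤ ν
  nonneg_le_one : ∀ᵐ x ∂ν, 0 ≤ c x ∧ c x ≤ 1
  cover : (ν.prod ν)
    ({p : Ω × Ω | W p.1 p.2 ≠ 0} \ {p : Ω × Ω | 1 ≤ c p.1 + c p.2}) = 0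

/-- The fractional cover ratio `τ(W)`: the infimum of the sizes `∫ c dν` of all fractional
vertex covers `c` of `W`. -/
noncomputable def fracCoverRatio (W : Graphon Ω) (ν : Measure Ω) : ℝ :=
  sInf {s : ℝ | ∃ c : Ω → ℝ, W.IsFractionalVertexCover ν c ∧ s = ∫ x, c x ∂ν}

/-- `W` and `U` are isomorphic: there is a measure-preserving bijection `φ` of `Ω` with
`W(x, y) = U(φ x, φ y)` for almost all `(x, y)`. -/
def Isomorphic (W U : Graphon Ω) (ν : Measure Ω) : Prop :=
  ∃ φ : Ω ≃ᵐ Ω, MeasurePreserving φ ν ν ∧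
    ∀ᵐ p : Ω × Ω ∂(ν.prod ν), W p.1 p.2 = U (φ p.1) (φ p.2)

/-- `U` is a representative of `Ψ_e`: for a partition `Ω = B ⊔ Bᶜ` with
`ν B = 1 - √(1 - e)`, `U` is `0` on `Bᶜ × Bᶜ` and `1` elsewhere. -/
def IsPsi (U : Graphon Ω) (ν : Measure Ω) (e : ℝ) : Prop :=
  ∃ B : Set Ω, MeasurableSet B ∧ ν.real B = 1 - √(1 - e) ∧
    (∀ x y, x ∉ B ∧ y ∉ B → U x y = 0) ∧ (∀ x y, ¬(x ∉ B ∧ y ∉ B) → U x y = 1)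

/-- `U` is a representative of `Φ_e`: for a partition `Ω = C ⊔ Cᶜ` with
`ν C = √e`, `U` is `1` on `C × C` and `0` elsewhere. -/
def IsPhi (U : Graphon Ω) (ν : Measure Ω) (e : ℝ) : Prop :=
  ∃ C : Set Ω, MeasurableSet C ∧ ν.real C = √e ∧
    (∀ x y, x ∈ C ∧ y ∈ C → U x y = 1) ∧ (∀ x y, ¬(x ∈ C ∧ y ∈ C) → U x y = 0)

/-- An atomless standard Borel probability space has measurable sets of every measure in
`[0,1]`. -/
theorem exists_measurableSet_measureReal_eq [StandardBorelSpace Ω] (ν : Measure Ω)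
    [IsProbabilityMeasure ν] [NullSingletonClass ν] {t : ℝ} (ht : t ∈ Set.Icc (0 : ℝ) 1) :
    ∃ B : Set Ω, MeasurableSet B ∧ ν.real B = t := by
  rcases eq_or_lt_of_le ht.1 with h0 | h0
  · exact ⟨∅, MeasurableSet.empty, by simp [← h0]⟩
  rcases eq_or_lt_of_le ht.2 with h1 | h1
  · exact ⟨Set.univ, MeasurableSet.univ, by simp [h1]⟩
  have hemb := measurableEmbedding_embeddingReal Ω
  set f := embeddingReal Ω with hf
  set μ := ν.map f with hμ
  have : IsProbabilityMeasure μ := Measure.isProbabilityMeasure_map hemb.measurable.aemeasurable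
  have hatom : ∀ x : ℝ, μ {x} = 0 := by
    intro x
    rw [hμ, hemb.map_apply]
    exact (Set.subsingleton_singleton.preimage hemb.injective).measure_zero ν
  have hcont : Continuous (ProbabilityTheory.cdf μ) := by
    rw [continuous_iff_continuousAt]
    intro x
    rw [continuousAt_iff_continuous_left'_right']
    constructor
    · refine (ProbabilityTheory.cdf μ).mono.continuousWithinAt_Iio_iff_leftLim_eq.2 ?_
      have h := (ProbabilityTheory.cdf μ).measure_singleton x
      rw [ProbabilityTheory.measure_cdf, hatom] at h
      have h2 := ENNReal.ofReal_eq_zero.1 h.symm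
      exact le_antisymm ((ProbabilityTheory.cdf μ).mono.leftLim_le le_rfl) (by linarith)
    · exact ((ProbabilityTheory.cdf μ).right_continuous x).mono Set.Ioi_subset_Ici_self
  obtain ⟨a, ha⟩ := ((ProbabilityTheory.tendsto_cdf_atBot μ).eventually (gt_mem_nhds h0)).exists
  obtain ⟨b, hb⟩ := ((ProbabilityTheory.tendsto_cdf_atTop μ).eventually (lt_mem_nhds h1)).exists
  obtain ⟨x, hx⟩ := mem_range_of_exists_le_of_exists_ge hcont ⟨a, ha.le⟩ ⟨b, hb.le⟩
  refine ⟨f ⁻¹' Set.Iic x, hemb.measurable measurableSet_Iic, ?_⟩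
  rw [← hx, ProbabilityTheory.cdf_eq_real, measureReal_def, measureReal_def, hμ, hemb.map_apply]

/-- `Ψ_e` exists. -/
theorem exists_isPsi [StandardBorelSpace Ω] (ν : Measure Ω)
    [IsProbabilityMeasure ν] [NullSingletonClass ν] {e : ℝ} (he : e ∈ Set.Icc (0 : ℝ) 1) :
    ∃ U : Graphon Ω, U.IsPsi ν e := by
  classical
  obtain ⟨B, hB, hν⟩ := exists_measurableSet_measureReal_eq ν (t := 1 - √(1 - e))
    ⟨by linarith [Real.sqrt_le_one.2 (by linarith [he.1] : 1 - e ≤ 1)],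
      by linarith [Real.sqrt_nonneg (1 - e)]⟩
  refine ⟨⟨fun x y => if x ∉ B ∧ y ∉ B then 0 else 1, ?_, ?_, ?_⟩, B, hB, hν, ?_, ?_⟩
  · refine Measurable.ite (p := fun p : Ω × Ω => p.1 ∉ B ∧ p.2 ∉ B) ?_ measurable_const
      measurable_const
    exact (measurable_fst hB.compl).inter (measurable_snd hB.compl)
  · intro x y; simp only [and_comm]
  · intro x y; split_ifs <;> simp
  · intro x y h; exact if_pos h
  · intro x y h; exact if_neg h

/-- `Φ_e` exists. -/
theorem exists_isPhi [StandardBorelSpace Ω] (ν : Measure Ω)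
    [IsProbabilityMeasure ν] [NullSingletonClass ν] {e : ℝ} (he : e ∈ Set.Icc (0 : ℝ) 1) :
    ∃ U : Graphon Ω, U.IsPhi ν e := by
  classical
  obtain ⟨C, hC, hν⟩ := exists_measurableSet_measureReal_eq ν (t := √e)
    ⟨Real.sqrt_nonneg e, Real.sqrt_le_one.2 he.2⟩
  refine ⟨⟨fun x y => if x ∈ C ∧ y ∈ C then 1 else 0, ?_, ?_, ?_⟩, C, hC, hν, ?_, ?_⟩
  · refine Measurable.ite (p := fun p : Ω × Ω => p.1 ∈ C ∧ p.2 ∈ C) ?_ measurable_const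
      measurable_const
    exact (measurable_fst hC).inter (measurable_snd hC)
  · intro x y; simp only [and_comm]
  · intro x y; split_ifs <;> simp
  · intro x y h; exact if_pos h
  · intro x y h; exact if_neg h

end Graphon

/-!
Cutting a fractional vertex cover `c` of `W` at the levels `t` and `1 - t` yields sets `P`, `A` such
that almost every pair in the support of `W` lies in `P ×ˢ univ ∪ univ ×ˢ A`, and averaging over `t`
shows that some `t` gives `ν P + ν A ≤ 2 ∫ c`. The sum `ν P + ν A` is modular on these covers, which
are closed under `(P ∪ P', A ∩ A')`, `(P ∩ P', A ∪ A')` and monotone limits, so `2 τ(W)` is attained,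
and by some `A ⊆ P`.

Let `a = ν A`, `p = ν P` and `t = τ(W)`, so that `a + p = 2 t`. The edge density is at most
`p² + 2 a (1 - p)`. This is a strictly convex function of `a ∈ [0, t]`, hence at most the larger of
its values `4 t²` at `a = 0` and `1 - (1 - t)²` at `a = t`, and this bound is equivalent to the
asserted one. Equality forces `a = 0` or `a = t` and makes `W` the indicator of the pairs that the
cover allows, which is `Φ_e` or `Ψ_e` for some set of the right measure.

The choice of this set does not matter up to isomorphism: distribution functions of real-valued
coordinates match any two sets of equal measure, and an uncountable null set gives room to turn an
almost everywhere defined matching into a bijection.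
-/

section

open Filter ProbabilityTheory Set Topology

variable {α β : Type*} [MeasurableSpace α] [MeasurableSpace β]

section EdgeDensity

variable {a p t e : ℝ}

theorem sqrt_div_four (e : ℝ) : √(e / 4) = √e / 2 := by
  rw [Real.sqrt_div' e (by norm_num), show (4 : ℝ) = 2 ^ 2 by norm_num, Real.sqrt_sq zero_le_two]

theorem min_sqrt_le_iff (ht0 : 0 ≤ t) (ht1 : t ≤ 1) (he1 : e ≤ 1) :
    min √(e / 4) (1 - √(1 - e)) ≤ t ↔ e ≤ max (4 * t ^ 2) (1 - (1 - t) ^ 2) := by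
  rw [min_le_iff, le_max_iff, Real.sqrt_le_left ht0, sub_le_comm,
    Real.le_sqrt (sub_nonneg.2 ht1) (sub_nonneg.2 he1)]
  exact or_congr (div_le_iff₀' four_pos) le_sub_comm

theorem le_min_sqrt_iff (ht0 : 0 ≤ t) (ht1 : t ≤ 1) (he0 : 0 ≤ e) :
    t ≤ min √(e / 4) (1 - √(1 - e)) ↔ max (4 * t ^ 2) (1 - (1 - t) ^ 2) ≤ e := by
  rw [le_min_iff, max_le_iff, Real.le_sqrt ht0 (by positivity), le_sub_comm,
    Real.sqrt_le_left (sub_nonneg.2 ht1)]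
  exact and_congr (le_div_iff₀' four_pos) sub_le_comm

theorem eq_min_sqrt_iff (ht0 : 0 ≤ t) (ht1 : t ≤ 1) (he0 : 0 ≤ e) (he1 : e ≤ 1) :
    t = min √(e / 4) (1 - √(1 - e)) ↔ e = max (4 * t ^ 2) (1 - (1 - t) ^ 2) := by
  rw [le_antisymm_iff, le_min_sqrt_iff ht0 ht1 he0, min_sqrt_le_iff ht0 ht1 he1, and_comm,
    ← le_antisymm_iff]

-- The left-hand side interpolates between `a = 0` and `a = t` with weights `(t - a) / t`, `a / t`.
theorem sq_add_two_mul_add_three_mul_le_max (ha : 0 ≤ a) (hap : a ≤ p) (ht : 2 * t = a + p) :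
    p ^ 2 + 2 * a * (1 - p) + 3 * a * (t - a) ≤ max (4 * t ^ 2) (1 - (1 - t) ^ 2) := by
  rcases (by linarith : 0 ≤ t).eq_or_lt with rfl | ht0
  · obtain rfl : a = 0 := by linarith
    obtain rfl : p = 0 := by linarith
    simp
  refine le_of_mul_le_mul_left ?_ ht0
  obtain rfl : p = 2 * t - a := by linarith
  set m := max (4 * t ^ 2) (1 - (1 - t) ^ 2)
  calc t * ((2 * t - a) ^ 2 + 2 * a * (1 - (2 * t - a)) + 3 * a * (t - a))
      = (t - a) * (4 * t ^ 2) + a * (1 - (1 - t) ^ 2) := by ring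
    _ ≤ (t - a) * m + a * m := by
        gcongr
        · linarith
        · exact le_max_left _ _
        · exact le_max_right _ _
    _ = t * m := by ring

theorem sq_add_two_mul_le_max (ha : 0 ≤ a) (hap : a ≤ p) (ht : 2 * t = a + p) :
    p ^ 2 + 2 * a * (1 - p) ≤ max (4 * t ^ 2) (1 - (1 - t) ^ 2) := by
  have hconvex := sq_add_two_mul_add_three_mul_le_max ha hap ht
  have hnonneg : 0 ≤ 3 * a * (t - a) := mul_nonneg (by linarith) (by linarith)
  linarith

theorem eq_or_eq_zero_of_max_le (ha : 0 ≤ a) (hap : a ≤ p) (ht : 2 * t = a + p)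
    (h : max (4 * t ^ 2) (1 - (1 - t) ^ 2) ≤ p ^ 2 + 2 * a * (1 - p)) : a = p ∨ a = 0 := by
  have hconvex := sq_add_two_mul_add_three_mul_le_max ha hap ht
  rcases ha.eq_or_lt with ha0 | ha0
  · exact .inr ha0.symm
  · have hle : t - a ≤ 0 := nonpos_of_mul_nonpos_right (by linarith) (by positivity : 0 < 3 * a)
    exact .inl (by linarith)

theorem sq_one_sub_le_iff {s : ℝ} (hs : s < 1) : (1 - s) ^ 2 ≤ (1 - s ^ 2) / 4 ↔ 0.6 ≤ s := by
  rw [show (1 - s ^ 2) / 4 = (1 - s) * ((1 + s) / 4) by ring, sq,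
    mul_le_mul_iff_right₀ (sub_pos.2 hs)]
  constructor <;> intro h <;> linarith

theorem le_sq_one_sub_iff {s : ℝ} (hs : s < 1) : (1 - s ^ 2) / 4 ≤ (1 - s) ^ 2 ↔ s ≤ 0.6 := by
  rw [show (1 - s ^ 2) / 4 = (1 - s) * ((1 + s) / 4) by ring, sq,
    mul_le_mul_iff_right₀ (sub_pos.2 hs)]
  constructor <;> intro h <;> linarith

theorem one_sub_sqrt_le_sqrt_iff (he : e ≤ 1) : 1 - √(1 - e) ≤ √(e / 4) ↔ e ≤ 0.64 := by
  rcases le_or_gt e 0 with he0 | he0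
  · have hone : 1 ≤ √(1 - e) := Real.one_le_sqrt.2 (by linarith)
    exact iff_of_true (by linarith [Real.sqrt_nonneg (e / 4)]) (by linarith)
  have hlt : √(1 - e) < 1 := by rw [Real.sqrt_lt' one_pos]; linarith
  calc 1 - √(1 - e) ≤ √(e / 4) ↔ (1 - √(1 - e)) ^ 2 ≤ (1 - √(1 - e) ^ 2) / 4 := by
        rw [Real.le_sqrt (sub_nonneg.2 hlt.le) (by positivity), Real.sq_sqrt (sub_nonneg.2 he),
          sub_sub_cancel]
    _ ↔ 0.6 ≤ √(1 - e) := sq_one_sub_le_iff hlt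
    _ ↔ e ≤ 0.64 := by
        rw [Real.le_sqrt (by norm_num) (sub_nonneg.2 he)]
        constructor <;> intro h <;> linarith

theorem sqrt_le_one_sub_sqrt_iff (he0 : 0 < e) (he1 : e ≤ 1) :
    √(e / 4) ≤ 1 - √(1 - e) ↔ 0.64 ≤ e := by
  have hlt : √(1 - e) < 1 := by rw [Real.sqrt_lt' one_pos]; linarith
  calc √(e / 4) ≤ 1 - √(1 - e) ↔ (1 - √(1 - e) ^ 2) / 4 ≤ (1 - √(1 - e)) ^ 2 := by
        rw [Real.sqrt_le_left (sub_nonneg.2 hlt.le), Real.sq_sqrt (sub_nonneg.2 he1),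
          sub_sub_cancel]
    _ ↔ √(1 - e) ≤ 0.6 := le_sq_one_sub_iff hlt
    _ ↔ 0.64 ≤ e := by
        rw [Real.sqrt_le_left (by norm_num)]
        constructor <;> intro h <;> linarith

end EdgeDensity

theorem uncountable_of_nullSingletonClass (μ : Measure α) [NullSingletonClass μ] [NeZero μ] :
    Uncountable α := by
  by_contra h
  rw [not_uncountable_iff] at h
  exact NeZero.ne μ (Measure.measure_univ_eq_zero.1 (countable_univ.measure_zero μ))

theorem exists_measurableSet_not_countable_measure_eq_zero [StandardBorelSpace α] [Uncountable α]
    (μ : Measure α) [SFinite μ] :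
    ∃ N, MeasurableSet N ∧ ¬ N.Countable ∧ μ N = 0 := by
  let ψ : α ≃ᵐ ℝ × ℝ := PolishSpace.measurableEquivOfNotCountable
    (not_countable_iff.2 inferInstance) (not_countable_iff.2 inferInstance)
  have hψ : Measurable fun a => (ψ a).1 := measurable_fst.comp ψ.measurable
  obtain ⟨x, hx⟩ : ∃ x, μ {a | (ψ a).1 = x} = 0 := by
    by_contra! hpos
    refine not_countable_univ (α := ℝ) ?_
    exact (Measure.countable_meas_level_set_pos hψ).mono fun x _ => pos_iff_ne_zero.2 (hpos x)
  refine ⟨_, hψ (measurableSet_singleton x), fun hc => not_countable_univ (α := ℝ) ?_, hx⟩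
  have hmaps : MapsTo (fun y => ψ.symm (x, y)) univ ((fun a => (ψ a).1) ⁻¹' {x}) :=
    fun y _ => by simp
  exact hmaps.countable_of_injOn (fun y _ z _ h => by simpa using h) hc

theorem exists_measurableEquiv_eqOn [StandardBorelSpace α] [StandardBorelSpace β] {f : α → β}
    (hf : Measurable f) {s : Set α} (hs : MeasurableSet s) (hinj : InjOn f s)
    (hsc : ¬ sᶜ.Countable) (hfsc : ¬ (f '' s)ᶜ.Countable) :
    ∃ φ : α ≃ᵐ β, EqOn φ f s := by
  classical
  rw [← range_domRestrict] at hfsc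
  have := hs.standardBorel
  have hfs : MeasurableEmbedding (s.domRestrict f) :=
    (hf.comp measurable_subtype_coe).measurableEmbedding hinj.injective
  have := hs.compl.standardBorel
  have := hfs.measurableSet_range.compl.standardBorel
  let onCompl := PolishSpace.measurableEquivOfNotCountable
    (mt countable_coe_iff.1 hsc) (mt countable_coe_iff.1 hfsc)
  refine ⟨(MeasurableEquiv.sumCompl hs).symm.trans <|
    (MeasurableEquiv.sumCongr hfs.equivRange onCompl).trans
      (MeasurableEquiv.sumCompl hfs.measurableSet_range), fun a ha => ?_⟩
  have hinl : (MeasurableEquiv.sumCompl hs).symm a = Sum.inl ⟨a, ha⟩ :=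
    Equiv.Set.sumCompl_symm_apply_of_mem ha
  change MeasurableEquiv.sumCompl hfs.measurableSet_range
    (Sum.map hfs.equivRange onCompl ((MeasurableEquiv.sumCompl hs).symm a)) = f a
  rw [hinl, Sum.map_inl, hfs.equivRange_apply]
  rfl

theorem exists_measurableEquiv_ae_eq [StandardBorelSpace α] [StandardBorelSpace β] {μ : Measure α}
    {ν : Measure β} [SFinite μ] [SFinite ν] [Uncountable α] [Uncountable β] {f : α → β}
    (hf : MeasurePreserving f μ ν) {s : Set α} (hs : MeasurableSet s) (hμs : ∀ᵐ a ∂μ, a ∈ s)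
    (hinj : InjOn f s) :
    ∃ φ : α ≃ᵐ β, φ =ᵐ[μ] f := by
  obtain ⟨M, hM, hMc, hM0⟩ := exists_measurableSet_not_countable_measure_eq_zero μ
  obtain ⟨N, hN, hNc, hN0⟩ := exists_measurableSet_not_countable_measure_eq_zero ν
  -- Removing `M` and `f ⁻¹' N` makes both complements uncountable, hence Borel isomorphic.
  set t := s \ (M ∪ f ⁻¹' N)
  have hMt : M ⊆ tᶜ := fun a ha hat => hat.2 (.inl ha)
  have hNt : N ⊆ (f '' t)ᶜ := by
    rintro _ hb ⟨a, hat, rfl⟩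
    exact hat.2 (.inr hb)
  obtain ⟨φ, hφ⟩ := exists_measurableEquiv_eqOn hf.measurable
    (hs.diff (hM.union (hf.measurable hN))) (hinj.mono sdiff_subset)
    (fun h => hMc (h.mono hMt)) (fun h => hNc (h.mono hNt))
  have hfN : μ (f ⁻¹' N) = 0 := by rw [hf.measure_preimage hN.nullMeasurableSet, hN0]
  refine ⟨φ, ?_⟩
  filter_upwards [hμs, measure_eq_zero_iff_ae_notMem.1 hM0,
    measure_eq_zero_iff_ae_notMem.1 hfN] with a has haM haN
  exact hφ ⟨has, fun h => h.elim haM haN⟩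

section CDF

variable (μ : Measure ℝ) [IsProbabilityMeasure μ] [NullSingletonClass μ]

theorem continuous_cdf : Continuous (cdf μ) := by
  refine continuous_iff_continuousAt.2 fun x => continuousAt_iff_continuous_left'_right'.2
    ⟨(cdf μ).mono.continuousWithinAt_Iio_iff_leftLim_eq.2 ?_,
      ((cdf μ).right_continuous x).mono Ioi_subset_Ici_self⟩
  have hjump : ENNReal.ofReal (cdf μ x - Function.leftLim (cdf μ) x) = 0 := by
    rw [← StieltjesFunction.measure_singleton, measure_cdf, measure_singleton]
  exact le_antisymm ((cdf μ).mono.leftLim_le le_rfl)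
    (sub_nonpos.1 (ENNReal.ofReal_eq_zero.1 hjump))

theorem exists_cdf_eq {u : ℝ} (hu : u ∈ Ioo 0 1) : ∃ x, cdf μ x = u := by
  obtain ⟨a, ha⟩ := ((tendsto_cdf_atBot μ).eventually (gt_mem_nhds hu.1)).exists
  obtain ⟨b, hb⟩ := ((tendsto_cdf_atTop μ).eventually (lt_mem_nhds hu.2)).exists
  exact mem_range_of_exists_le_of_exists_ge (continuous_cdf μ) ⟨a, ha.le⟩ ⟨b, hb.le⟩

theorem measureReal_cdf_lt_le {u : ℝ} (hu : u ∈ Ioo 0 1) : μ.real {x | cdf μ x < u} ≤ u := by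
  obtain ⟨x, rfl⟩ := exists_cdf_eq μ hu
  nth_rw 2 [cdf_eq_real]
  exact measureReal_mono fun y hy => ((monotone_cdf μ).reflect_lt hy).le

theorem measureReal_cdf_le {u : ℝ} (hu : u ∈ Ico 0 1) : μ.real {x | cdf μ x ≤ u} = u := by
  refine le_antisymm (le_of_forall_gt_imp_ge_of_dense fun v hv => ?_) ?_
  · rcases lt_or_ge v 1 with hv1 | hv1
    · calc μ.real {x | cdf μ x ≤ u} ≤ μ.real {x | cdf μ x < v} :=
            measureReal_mono fun x hx => lt_of_le_of_lt hx hv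
        _ ≤ v := measureReal_cdf_lt_le μ ⟨hu.1.trans_lt hv, hv1⟩
    · exact measureReal_le_one.trans hv1
  · rcases hu.1.eq_or_lt with rfl | hu0
    · exact measureReal_nonneg
    · obtain ⟨x, rfl⟩ := exists_cdf_eq μ ⟨hu0, hu.2⟩
      calc cdf μ x = μ.real (Iic x) := cdf_eq_real μ x
        _ ≤ μ.real {y | cdf μ y ≤ cdf μ x} := measureReal_mono fun y hy => monotone_cdf μ hy

theorem measurePreserving_cdf : MeasurePreserving (cdf μ) μ (volume.restrict (Ioc 0 1)) := by
  have hcdf := (continuous_cdf μ).measurable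
  have := Measure.isProbabilityMeasure_map (μ := μ) hcdf.aemeasurable
  have : IsProbabilityMeasure (volume.restrict (Ioc (0 : ℝ) 1)) := ⟨by simp⟩
  refine ⟨hcdf, Measure.ext_of_Iic _ _ fun u => ?_⟩
  rw [Measure.map_apply hcdf measurableSet_Iic, Measure.restrict_apply measurableSet_Iic,
    inter_comm, Ioc_inter_Iic, Real.volume_Ioc, sub_zero, ← ofReal_measureReal]
  rcases lt_or_ge u 0 with hu0 | hu0
  · have hempty : cdf μ ⁻¹' Iic u = ∅ :=
      eq_empty_of_forall_notMem fun x hx => (hu0.trans_le (cdf_nonneg μ x)).not_ge hx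
    rw [hempty, measureReal_empty, min_eq_right (by linarith), ENNReal.ofReal_zero,
      ENNReal.ofReal_of_nonpos hu0.le]
  rcases lt_or_ge u 1 with hu1 | hu1
  · rw [min_eq_right hu1.le]
    exact congrArg ENNReal.ofReal (measureReal_cdf_le μ ⟨hu0, hu1⟩)
  · have huniv : cdf μ ⁻¹' Iic u = univ := eq_univ_of_forall fun x => (cdf_le_one μ x).trans hu1
    rw [huniv, probReal_univ, min_eq_left hu1]

theorem exists_injOn_cdf : ∃ s, MeasurableSet s ∧ (∀ᵐ x ∂μ, x ∈ s) ∧ InjOn (cdf μ) s := by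
  have hcdf := measurePreserving_cdf μ
  -- Any interval on which `cdf μ` is constant contains a rational.
  refine ⟨⋂ q : ℚ, cdf μ ⁻¹' {cdf μ q}ᶜ,
    .iInter fun q => hcdf.measurable (measurableSet_singleton _).compl, ?_, ?_⟩
  · simp only [mem_iInter]
    exact ae_all_iff.2 fun q => hcdf.quasiMeasurePreserving.ae (Measure.ae_ne _ _)
  · have hle {x y : ℝ} (hy : y ∈ ⋂ q : ℚ, cdf μ ⁻¹' {cdf μ q}ᶜ) (hxy : cdf μ x = cdf μ y) :
        y ≤ x := by
      by_contra! hlt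
      obtain ⟨q, hxq, hqy⟩ := exists_rat_btwn hlt
      exact mem_iInter.1 hy q
        ((hxy.symm.trans_le (monotone_cdf μ hxq.le)).antisymm (monotone_cdf μ hqy.le))
    exact fun x hx y hy hxy => (hle hx hxy.symm).antisymm (hle hy hxy)

end CDF

theorem exists_measurableEmbedding_real [StandardBorelSpace α] {B : Set α} (hB : MeasurableSet B) :
    ∃ ι : α → ℝ, MeasurableEmbedding ι ∧ ι ⁻¹' Iic 0 = B := by
  classical
  have hexp : Measurable fun a => Real.exp (embeddingReal α a) :=
    Real.measurable_exp.comp (measurableEmbedding_embeddingReal α).measurable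
  let ι : α → ℝ := fun a =>
    if a ∈ B then -Real.exp (embeddingReal α a) else Real.exp (embeddingReal α a)
  have hι_nonpos (a : α) : ι a ≤ 0 ↔ a ∈ B := by
    by_cases ha : a ∈ B <;> simp [ι, ha, Real.exp_pos, Real.exp_nonneg]
  have hι : Measurable ι := .ite hB hexp.neg hexp
  refine ⟨ι, hι.measurableEmbedding fun a b hab => ?_, ext hι_nonpos⟩
  have hmem : a ∈ B ↔ b ∈ B := by rw [← hι_nonpos, ← hι_nonpos, hab]
  refine (measurableEmbedding_embeddingReal α).injective (Real.exp_injective ?_)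
  by_cases ha : a ∈ B
  · simpa [ι, ha, hmem.1 ha] using hab
  · simpa [ι, ha, mt hmem.2 ha] using hab

theorem exists_measurableEquiv_real [StandardBorelSpace α] (μ : Measure α) [IsProbabilityMeasure μ]
    [NullSingletonClass μ] {B : Set α} (hB : MeasurableSet B) :
    ∃ φ : α ≃ᵐ ℝ, MeasurePreserving φ μ (volume.restrict (Ioc 0 1)) ∧
      B =ᵐ[μ] φ ⁻¹' Iic (μ.real B) := by
  obtain ⟨ι, hι, hιB⟩ := exists_measurableEmbedding_real hB
  have := Measure.isProbabilityMeasure_map (μ := μ) hι.measurable.aemeasurable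
  have : NullSingletonClass (μ.map ι) := ⟨fun x => by
    rw [hι.map_apply]
    exact (subsingleton_singleton.preimage hι.injective).measure_zero μ⟩
  have := uncountable_of_nullSingletonClass μ
  obtain ⟨s, hs, hμs, hinj⟩ := exists_injOn_cdf (μ.map ι)
  have hf : MeasurePreserving (cdf (μ.map ι) ∘ ι) μ (volume.restrict (Ioc 0 1)) :=
    (measurePreserving_cdf (μ.map ι)).comp (hι.measurable.measurePreserving μ)
  obtain ⟨φ, hφ⟩ := exists_measurableEquiv_ae_eq hf (hι.measurable hs)
    (ae_of_ae_map hι.measurable.aemeasurable hμs)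
    (hinj.comp hι.injective.injOn (mapsTo_preimage ι s))
  have hφμ : MeasurePreserving φ μ (volume.restrict (Ioc 0 1)) :=
    ⟨φ.measurable, (Measure.map_congr hφ).trans hf.map_eq⟩
  refine ⟨φ, hφμ, ?_⟩
  have hB0 : μ.real B = cdf (μ.map ι) 0 := by
    rw [cdf_eq_real, map_measureReal_apply hι.measurable measurableSet_Iic, hιB]
  have hsub : B ≤ᵐ[μ] φ ⁻¹' Iic (μ.real B) := by
    filter_upwards [hφ] with a ha haB
    change φ a ≤ μ.real B
    rw [ha, hB0]
    exact monotone_cdf _ (hιB.ge haB)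
  have hmeasure : μ (φ ⁻¹' Iic (μ.real B)) = μ B := by
    rw [hφμ.measure_preimage measurableSet_Iic.nullMeasurableSet,
      Measure.restrict_apply measurableSet_Iic, inter_comm, Ioc_inter_Iic,
      min_eq_right measureReal_le_one, Real.volume_Ioc, sub_zero, ofReal_measureReal]
  exact ae_eq_of_ae_subset_of_measure_ge hsub hmeasure.le hB.nullMeasurableSet (measure_ne_top _ _)

theorem exists_measurableEquiv_measurePreserving [StandardBorelSpace α] [StandardBorelSpace β]
    (μ : Measure α) (ν : Measure β) [IsProbabilityMeasure μ] [NullSingletonClass μ]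
    [IsProbabilityMeasure ν] [NullSingletonClass ν] {B : Set α} {B' : Set β}
    (hB : MeasurableSet B) (hB' : MeasurableSet B') (hBB' : μ.real B = ν.real B') :
    ∃ φ : α ≃ᵐ β, MeasurePreserving φ μ ν ∧ B =ᵐ[μ] φ ⁻¹' B' := by
  obtain ⟨φ, hφ, hφB⟩ := exists_measurableEquiv_real μ hB
  obtain ⟨ψ, hψ, hψB'⟩ := exists_measurableEquiv_real ν hB'
  have hφψ : MeasurePreserving (φ.trans ψ.symm) μ ν := (hψ.symm ψ).comp hφ
  refine ⟨φ.trans ψ.symm, hφψ, hφB.trans ?_⟩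
  have h := hφψ.quasiMeasurePreserving.preimage_ae_eq hψB'
  rw [← preimage_comp, ← hBB'] at h
  simpa [Function.comp_def] using h.symm

theorem exists_measureReal_superlevel_add_le {μ : Measure α} [IsFiniteMeasure μ] {f : α → ℝ}
    (hf : Integrable f μ) (hf0 : 0 ≤ᵐ[μ] f) (hf1 : f ≤ᵐ[μ] fun _ => 1) :
    ∃ t, μ.real {a | t ≤ f a} + μ.real {a | 1 - t ≤ f a} ≤ 2 * ∫ a, f a ∂μ := by
  set g : ℝ → ℝ := fun t => μ.real {a | t ≤ f a}
  have hg : Antitone g := fun s t hst => measureReal_mono fun a ha => hst.trans ha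
  have hg_integral : ∫ t in Ioc 0 1, g t = ∫ a, f a ∂μ :=
    (hf.integral_eq_integral_Ioc_meas_le hf0 hf1).symm
  have hg' : IntegrableOn g (Ioc 0 1) := hg.intervalIntegrable.1
  have hg'_reflect : IntegrableOn (fun t => g (1 - t)) (Ioc 0 1) :=
    (hg.comp fun _ _ h => sub_le_sub_left h 1).intervalIntegrable.1
  have hreflect : ∫ t in Ioc 0 1, g (1 - t) = ∫ t in Ioc 0 1, g t := by
    rw [← intervalIntegral.integral_of_le zero_le_one,
      intervalIntegral.integral_comp_sub_left g, sub_self, sub_zero,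
      intervalIntegral.integral_of_le zero_le_one]
  obtain ⟨t, -, ht⟩ := exists_le_setAverage (μ := volume) (s := Ioc (0 : ℝ) 1) (by simp) (by simp)
    (hg'.add hg'_reflect)
  refine ⟨t, ht.trans_eq ?_⟩
  rw [setAverage_eq, integral_add' hg' hg'_reflect, hreflect, hg_integral]
  simp [two_mul]

namespace Graphon

variable {W : Graphon α} {ν : Measure α} {P A P' A' : Set α}

theorem IsFractionalVertexCover.fracCoverRatio_le {c : α → ℝ} (hc : W.IsFractionalVertexCover ν c) :
    W.fracCoverRatio ν ≤ ∫ x, c x ∂ν := by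
  refine csInf_le ⟨0, ?_⟩ ⟨c, hc, rfl⟩
  rintro _ ⟨d, hd, rfl⟩
  exact integral_nonneg_of_ae (hd.nonneg_le_one.mono fun _ hx => hx.1)

theorem IsFractionalVertexCover.congr_ae [SFinite ν] {c d : α → ℝ}
    (hc : W.IsFractionalVertexCover ν c) (hcd : c =ᵐ[ν] d) :
    W.IsFractionalVertexCover ν d where
  memLp := hc.memLp.ae_eq hcd
  nonneg_le_one := by
    filter_upwards [hc.nonneg_le_one, hcd] with x hx hcdx
    rwa [← hcdx]
  cover := by
    rw [measure_eq_zero_iff_ae_notMem]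
    filter_upwards [measure_eq_zero_iff_ae_notMem.1 hc.cover,
      Measure.quasiMeasurePreserving_fst.ae hcd,
      Measure.quasiMeasurePreserving_snd.ae hcd] with z hz hfst hsnd
    rintro ⟨hW, hd⟩
    exact hz ⟨hW, fun h => hd (by simpa [hfst, hsnd] using h)⟩

theorem exists_isFractionalVertexCover_lt [IsFiniteMeasure ν] {r : ℝ}
    (hr : W.fracCoverRatio ν < r) :
    ∃ c, W.IsFractionalVertexCover ν c ∧ ∫ x, c x ∂ν < r := by
  have hone : W.IsFractionalVertexCover ν fun _ => 1 :=
    ⟨memLp_const 1, by simp, by norm_num⟩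
  obtain ⟨_, ⟨c, hc, rfl⟩, hcr⟩ := exists_lt_of_csInf_lt
    (s := {s | ∃ c, W.IsFractionalVertexCover ν c ∧ s = ∫ x, c x ∂ν}) ⟨_, _, hone, rfl⟩ hr
  exact ⟨c, hc, hcr⟩

/-- An integral vertex cover of the bipartite double of `W`: almost every pair in the support of
`W` has its first vertex in `P` or its second vertex in `A`. -/
structure IsBipartiteCover (W : Graphon α) (ν : Measure α) (P A : Set α) : Prop where
  left : MeasurableSet P
  right : MeasurableSet A
  cover : ∀ᵐ z ∂ν.prod ν, W z.1 z.2 ≠ 0 → z.1 ∈ P ∨ z.2 ∈ A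

namespace IsBipartiteCover

theorem symm [SFinite ν] (h : W.IsBipartiteCover ν P A) : W.IsBipartiteCover ν A P where
  left := h.right
  right := h.left
  cover := by
    filter_upwards [Measure.measurePreserving_swap.quasiMeasurePreserving.ae h.cover] with z hz hW
    exact (hz (by rwa [Prod.fst_swap, Prod.snd_swap, W.symm'])).symm

theorem iUnion_iInter {ι : Sort*} [Countable ι] {P A : ι → Set α}
    (h : ∀ i, W.IsBipartiteCover ν (P i) (A i)) : W.IsBipartiteCover ν (⋃ i, P i) (⋂ i, A i) where
  left := .iUnion fun i => (h i).left
  right := .iInter fun i => (h i).right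
  cover := by
    filter_upwards [ae_all_iff.2 fun i => (h i).cover] with z hz hW
    simp only [mem_iUnion, mem_iInter]
    by_contra! hcon
    obtain ⟨i, hi⟩ := hcon.2
    exact (hz i hW).elim (hcon.1 i) hi

theorem union_inter (h : W.IsBipartiteCover ν P A) (h' : W.IsBipartiteCover ν P' A') :
    W.IsBipartiteCover ν (P ∪ P') (A ∩ A') := by
  rw [union_eq_iUnion, inter_eq_iInter]
  exact iUnion_iInter (Bool.forall_bool.2 ⟨h', h⟩)

theorem inter_union [SFinite ν] (h : W.IsBipartiteCover ν P A) (h' : W.IsBipartiteCover ν P' A') :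
    W.IsBipartiteCover ν (P ∩ P') (A ∪ A') :=
  (h.symm.union_inter h'.symm).symm

theorem isFractionalVertexCover [IsFiniteMeasure ν] (h : W.IsBipartiteCover ν P A) :
    W.IsFractionalVertexCover ν (P.indicator (fun _ => 1 / 2) + A.indicator fun _ => 1 / 2) := by
  have hmemLp {S : Set α} (hS : MeasurableSet S) : MemLp (S.indicator fun _ => (1 / 2 : ℝ)) ⊤ ν :=
    (memLp_const _).indicator hS
  have half_le {x y : α} {S T : Set α} (hxy : x ∈ S ∨ y ∈ T) :
      (1 / 2 : ℝ) ≤ S.indicator (fun _ => 1 / 2) x + T.indicator (fun _ => 1 / 2) y := by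
    by_cases hx : x ∈ S <;> by_cases hy : y ∈ T <;> simp_all
  refine ⟨(hmemLp h.left).add (hmemLp h.right), .of_forall fun x => ?_, ?_⟩
  · by_cases hP : x ∈ P <;> by_cases hA : x ∈ A <;> norm_num [hP, hA]
  · rw [measure_eq_zero_iff_ae_notMem]
    filter_upwards [h.cover, h.symm.cover] with z hPA hAP hz
    have hfst_snd := half_le (hPA hz.1)
    have hsnd_fst := half_le (hAP hz.1)
    refine hz.2 ?_
    simp only [mem_ofPred_eq, Pi.add_apply]
    linarith

theorem two_mul_fracCoverRatio_le [IsFiniteMeasure ν] (h : W.IsBipartiteCover ν P A) :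
    2 * W.fracCoverRatio ν ≤ ν.real P + ν.real A := by
  have hintegrable {S : Set α} (hS : MeasurableSet S) :
      Integrable (S.indicator fun _ => (1 / 2 : ℝ)) ν :=
    (integrable_const _).indicator hS
  have hle := h.isFractionalVertexCover.fracCoverRatio_le
  rw [integral_add' (hintegrable h.left) (hintegrable h.right), integral_indicator_const _ h.left,
    integral_indicator_const _ h.right, smul_eq_mul, smul_eq_mul] at hle
  linarith

end IsBipartiteCover

theorem IsFractionalVertexCover.exists_isBipartiteCover_le [IsFiniteMeasure ν] {c : α → ℝ}
    (hc : W.IsFractionalVertexCover ν c) :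
    ∃ P A, W.IsBipartiteCover ν P A ∧ ν.real P + ν.real A ≤ 2 * ∫ x, c x ∂ν := by
  obtain ⟨d, hd, hcd⟩ := hc.memLp.1.aemeasurable
  have hdc := hc.congr_ae hcd
  obtain ⟨t, ht⟩ := exists_measureReal_superlevel_add_le (hdc.memLp.integrable le_top)
    (hdc.nonneg_le_one.mono fun _ hx => hx.1) (hdc.nonneg_le_one.mono fun _ hx => hx.2)
  rw [← integral_congr_ae hcd] at ht
  have hsuperlevel (s : ℝ) : MeasurableSet {x | s ≤ d x} := measurableSet_le measurable_const hd
  refine ⟨_, _, ⟨hsuperlevel t, hsuperlevel (1 - t), ?_⟩, ht⟩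
  filter_upwards [measure_eq_zero_iff_ae_notMem.1 hdc.cover] with z hz hW
  by_contra! hcon
  exact hz ⟨hW, (by linarith [hcon.1, hcon.2] : ¬ 1 ≤ d z.1 + d z.2)⟩

section Attainment

variable [IsFiniteMeasure ν]

theorem exists_isBipartiteCover_lt {r : ℝ} (hr : 2 * W.fracCoverRatio ν < r) :
    ∃ P A, W.IsBipartiteCover ν P A ∧ ν.real P + ν.real A < r := by
  obtain ⟨c, hc, hcr⟩ := exists_isFractionalVertexCover_lt (lt_div_iff₀' zero_lt_two |>.2 hr)
  obtain ⟨P, A, h, hle⟩ := hc.exists_isBipartiteCover_le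
  exact ⟨P, A, h, by linarith⟩

namespace IsBipartiteCover

theorem measureReal_union_add_inter_le (h : W.IsBipartiteCover ν P A)
    (h' : W.IsBipartiteCover ν P' A') :
    ν.real (P ∪ P') + ν.real (A ∩ A') ≤
      (ν.real P + ν.real A) + (ν.real P' + ν.real A') - 2 * W.fracCoverRatio ν := by
  have hmin := (h.inter_union h').two_mul_fracCoverRatio_le
  have hP := measureReal_union_add_inter (μ := ν) (s := P) h'.left
  have hA := measureReal_union_add_inter (μ := ν) (s := A) h'.right
  linarith

variable {P A : ℕ → Set α} {ε : ℕ → ℝ} {s : ℝ}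

theorem measureReal_biUnion_add_biInter_le (h : ∀ k, W.IsBipartiteCover ν (P k) (A k))
    (hε : ∀ k, ν.real (P k) + ν.real (A k) ≤ 2 * W.fracCoverRatio ν + ε k) (n : ℕ) :
    ν.real (⋃ k ≤ n, P k) + ν.real (⋂ k ≤ n, A k) ≤
      2 * W.fracCoverRatio ν + ∑ k ∈ Finset.range (n + 1), ε k := by
  induction n with
  | zero => simpa using hε 0
  | succ n ih =>
    have hn : W.IsBipartiteCover ν (⋃ k ≤ n, P k) (⋂ k ≤ n, A k) :=
      iUnion_iInter fun k => iUnion_iInter fun _ => h k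
    rw [biUnion_le_succ, biInter_le_succ, Finset.sum_range_succ]
    linarith [hn.measureReal_union_add_inter_le (h (n + 1)), hε (n + 1)]

theorem measureReal_iUnion_add_iInter_le (h : ∀ k, W.IsBipartiteCover ν (P k) (A k))
    (hε : ∀ k, ν.real (P k) + ν.real (A k) ≤ 2 * W.fracCoverRatio ν + ε k) (hs : HasSum ε s) :
    ν.real (⋃ k, P k) + ν.real (⋂ k, A k) ≤ 2 * W.fracCoverRatio ν + s := by
  have hP : Tendsto (fun n => ν.real (⋃ k ≤ n, P k)) atTop (𝓝 (ν.real (⋃ k, P k))) :=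
    (ENNReal.tendsto_toReal (measure_ne_top _ _)).comp tendsto_measure_iUnion_accumulate
  have hA : Tendsto (fun n => ν.real (⋂ k ≤ n, A k)) atTop (𝓝 (ν.real (⋂ k, A k))) :=
    (ENNReal.tendsto_toReal (measure_ne_top _ _)).comp
      (tendsto_measure_iInter_le (fun k => (h k).right.nullMeasurableSet) ⟨0, measure_ne_top _ _⟩)
  exact le_of_tendsto_of_tendsto' (hP.add hA)
    ((hs.tendsto_sum_nat.comp (tendsto_add_atTop_nat 1)).const_add _)
    (measureReal_biUnion_add_biInter_le h hε)

theorem tendsto_measureReal_iInter_add_iUnion (h : ∀ k, W.IsBipartiteCover ν (P k) (A k))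
    (hP : Antitone P) (hA : Monotone A) :
    Tendsto (fun n => ν.real (P n) + ν.real (A n)) atTop
      (𝓝 (ν.real (⋂ k, P k) + ν.real (⋃ k, A k))) :=
  ((ENNReal.tendsto_toReal (measure_ne_top _ _)).comp (tendsto_measure_iInter_atTop
    (fun k => (h k).left.nullMeasurableSet) hP ⟨0, measure_ne_top _ _⟩)).add
  ((ENNReal.tendsto_toReal (measure_ne_top _ _)).comp (tendsto_measure_iUnion_atTop hA))

end IsBipartiteCover

theorem exists_isBipartiteCover_le_two_mul_fracCoverRatio (W : Graphon α) (ν : Measure α)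
    [IsFiniteMeasure ν] :
    ∃ P A, W.IsBipartiteCover ν P A ∧ ν.real P + ν.real A ≤ 2 * W.fracCoverRatio ν := by
  choose P A h hlt using fun n : ℕ => W.exists_isBipartiteCover_lt (ν := ν)
    (lt_add_of_pos_right (2 * W.fracCoverRatio ν) (by positivity : (0 : ℝ) < 1 / 2 / 2 ^ n))
  have hgeom (n : ℕ) : HasSum (fun k => (1 : ℝ) / 2 / 2 ^ (n + k)) (1 / 2 ^ n) := by
    convert hasSum_geometric_two' ((1 : ℝ) / 2 ^ n) using 2 with k
    rw [pow_add]
    field_simp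
  -- The tails lose `1 / 2 ^ n` by submodularity, and they are monotone in `n`.
  have htail (n : ℕ) : W.IsBipartiteCover ν (⋃ k, P (n + k)) (⋂ k, A (n + k)) :=
    .iUnion_iInter fun k => h (n + k)
  have hP : Antitone fun n => ⋃ k, P (n + k) := antitone_nat_of_succ_le fun n =>
    iUnion_subset fun k => (subset_iUnion (fun k => P (n + k)) (1 + k)).trans' (by rw [add_assoc])
  have hA : Monotone fun n => ⋂ k, A (n + k) := monotone_nat_of_le_succ fun n =>
    subset_iInter fun k => (iInter_subset (fun k => A (n + k)) (1 + k)).trans (by rw [add_assoc])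
  refine ⟨_, _, (IsBipartiteCover.iUnion_iInter fun n => (htail n).symm).symm, ?_⟩
  refine le_of_tendsto_of_tendsto'
    (IsBipartiteCover.tendsto_measureReal_iInter_add_iUnion htail hP hA) ?_ fun n =>
      IsBipartiteCover.measureReal_iUnion_add_iInter_le (fun k => h (n + k))
        (fun k => (hlt (n + k)).le) (hgeom n)
  simpa [one_div] using ((tendsto_pow_atTop_nhds_zero_of_lt_one (by norm_num)
    (by norm_num : (1 / 2 : ℝ) < 1)).const_add (2 * W.fracCoverRatio ν))

/-- Such a pair encodes a half-integral optimal fractional vertex cover: `1` on `A`, `1 / 2` on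
`P \ A` and `0` off `P`. -/
theorem exists_isBipartiteCover_eq (W : Graphon α) (ν : Measure α) [IsFiniteMeasure ν] :
    ∃ P A, W.IsBipartiteCover ν P A ∧ A ⊆ P ∧ ν.real P + ν.real A = 2 * W.fracCoverRatio ν := by
  obtain ⟨P, A, h, hle⟩ := W.exists_isBipartiteCover_le_two_mul_fracCoverRatio ν
  have hsym := h.union_inter h.symm
  refine ⟨P ∪ A, A ∩ P, hsym, inter_subset_left.trans subset_union_right, ?_⟩
  refine le_antisymm ?_ hsym.two_mul_fracCoverRatio_le
  rwa [inter_comm, measureReal_union_add_inter h.right]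

end Attainment
end Graphon

namespace Graphon

variable {W U : Graphon α} {ν : Measure α} {P A P' A' : Set α} {e : ℝ}

/-- The pairs both of whose orderings are covered by `(P, A)`. These are the pairs where a graphon
with bipartite cover `(P, A)` may be nonzero: `(Pᶜ ×ˢ Pᶜ)ᶜ` if `A = P` and `P ×ˢ P` if `A = ∅`. -/
def coveredPairs (P A : Set α) : Set (α × α) :=
  {z | (z.1 ∈ P ∨ z.2 ∈ A) ∧ (z.1 ∈ A ∨ z.2 ∈ P)}

theorem measurableSet_coveredPairs (hP : MeasurableSet P) (hA : MeasurableSet A) :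
    MeasurableSet (coveredPairs P A) :=
  ((measurable_fst hP).union (measurable_snd hA)).inter
    ((measurable_fst hA).union (measurable_snd hP))

theorem coveredPairs_eq_of_subset {ι : Type*} {P A : Set ι} (hAP : A ⊆ P) :
    coveredPairs P A = P ×ˢ P ∪ (A ×ˢ Pᶜ ∪ Pᶜ ×ˢ A) := by
  ext z
  have hfst := @hAP z.1
  have hsnd := @hAP z.2
  simp only [coveredPairs, mem_ofPred_eq, mem_union, mem_prod, mem_compl_iff]
  tauto

theorem measureReal_coveredPairs [IsProbabilityMeasure ν] (hP : MeasurableSet P)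
    (hA : MeasurableSet A) (hAP : A ⊆ P) :
    (ν.prod ν).real (coveredPairs P A) = ν.real P ^ 2 + 2 * ν.real A * (1 - ν.real P) := by
  have hdisj : Disjoint A Pᶜ := disjoint_compl_right_iff_subset.2 hAP
  have hdisj_cross : Disjoint (A ×ˢ Pᶜ) (Pᶜ ×ˢ A) := disjoint_prod.2 (.inl hdisj)
  have hdisj_diag : Disjoint (P ×ˢ P) (A ×ˢ Pᶜ ∪ Pᶜ ×ˢ A) :=
    .sup_right (disjoint_prod.2 (.inr disjoint_compl_right))
      (disjoint_prod.2 (.inl disjoint_compl_right))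
  rw [coveredPairs_eq_of_subset hAP,
    measureReal_union hdisj_diag ((hA.prod hP.compl).union (hP.compl.prod hA)),
    measureReal_union hdisj_cross (hP.compl.prod hA), measureReal_prod_prod, measureReal_prod_prod,
    measureReal_prod_prod, probReal_compl_eq_one_sub hP]
  ring

theorem integrable [IsFiniteMeasure ν] (W : Graphon α) :
    Integrable (fun z : α × α => W z.1 z.2) (ν.prod ν) :=
  .of_bound W.measurable'.aestronglyMeasurable 1 <| .of_forall fun z => by
    rw [Real.norm_of_nonneg (W.mem_Icc' _ _).1]
    exact (W.mem_Icc' _ _).2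

theorem edgeDensity_mem_Icc [IsProbabilityMeasure ν] (W : Graphon α) :
    W.edgeDensity ν ∈ Icc (0 : ℝ) 1 := by
  refine ⟨integral_nonneg fun z => (W.mem_Icc' _ _).1, ?_⟩
  calc W.edgeDensity ν ≤ ∫ _ : α × α, (1 : ℝ) ∂(ν.prod ν) :=
        integral_mono W.integrable (integrable_const _) fun z => (W.mem_Icc' _ _).2
    _ = 1 := by simp

/-- `W` is, up to a null set, the indicator of the pairs covered by `(P, A)`, that is, the largest
graphon with bipartite cover `(P, A)`. The representatives of `Ψ_e` and `Φ_e` are of this form. -/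
structure IsCoverIndicator (W : Graphon α) (ν : Measure α) (P A : Set α) : Prop where
  left : MeasurableSet P
  right : MeasurableSet A
  ae_eq : ∀ᵐ z ∂ν.prod ν, W z.1 z.2 = (coveredPairs P A).indicator 1 z

namespace IsBipartiteCover

theorem preimage [SFinite ν] {φ : α ≃ᵐ α} (hφ : MeasurePreserving φ ν ν)
    (hWU : ∀ᵐ z ∂ν.prod ν, W z.1 z.2 = U (φ z.1) (φ z.2)) (h : U.IsBipartiteCover ν P A) :
    W.IsBipartiteCover ν (φ ⁻¹' P) (φ ⁻¹' A) where
  left := φ.measurable h.left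
  right := φ.measurable h.right
  cover := by
    filter_upwards [hWU, (hφ.prod hφ).quasiMeasurePreserving.ae h.cover] with z hz hcover hW
    exact hcover (hz ▸ hW)

theorem ae_le_indicator [SFinite ν] (h : W.IsBipartiteCover ν P A) :
    ∀ᵐ z ∂ν.prod ν, W z.1 z.2 ≤ (coveredPairs P A).indicator 1 z := by
  filter_upwards [h.cover, h.symm.cover] with z hPA hAP
  by_cases hz : W z.1 z.2 = 0
  · rw [hz]
    exact indicator_nonneg (fun _ _ => zero_le_one) z
  · rw [indicator_of_mem (show z ∈ coveredPairs P A from ⟨hPA hz, hAP hz⟩)]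
    exact (W.mem_Icc' _ _).2

theorem integrable_indicator [IsFiniteMeasure ν] (h : W.IsBipartiteCover ν P A) :
    Integrable ((coveredPairs P A).indicator (1 : α × α → ℝ)) (ν.prod ν) :=
  (integrable_const (1 : ℝ)).indicator (measurableSet_coveredPairs h.left h.right)

variable [IsProbabilityMeasure ν]

theorem integral_indicator (h : W.IsBipartiteCover ν P A) (hAP : A ⊆ P) :
    ∫ z, (coveredPairs P A).indicator (1 : α × α → ℝ) z ∂ν.prod ν =
      ν.real P ^ 2 + 2 * ν.real A * (1 - ν.real P) := by
  rw [integral_indicator_one (measurableSet_coveredPairs h.left h.right),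
    measureReal_coveredPairs h.left h.right hAP]

theorem edgeDensity_le (h : W.IsBipartiteCover ν P A) (hAP : A ⊆ P) :
    W.edgeDensity ν ≤ ν.real P ^ 2 + 2 * ν.real A * (1 - ν.real P) := by
  rw [← h.integral_indicator hAP]
  exact integral_mono_ae W.integrable h.integrable_indicator h.ae_le_indicator

theorem isCoverIndicator (h : W.IsBipartiteCover ν P A) (hAP : A ⊆ P)
    (he : W.edgeDensity ν = ν.real P ^ 2 + 2 * ν.real A * (1 - ν.real P)) :
    W.IsCoverIndicator ν P A where
  left := h.left
  right := h.right
  ae_eq := by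
    rw [← h.integral_indicator hAP] at he
    exact (integral_eq_iff_of_ae_le W.integrable h.integrable_indicator h.ae_le_indicator).1 he

end IsBipartiteCover

namespace IsCoverIndicator

theorem isBipartiteCover (h : W.IsCoverIndicator ν P A) : W.IsBipartiteCover ν P A where
  left := h.left
  right := h.right
  cover := h.ae_eq.mono fun _ hz hW => (mem_of_indicator_ne_zero (hz ▸ hW)).1

theorem congr_right [SFinite ν] (h : W.IsCoverIndicator ν P A) (hA' : MeasurableSet A')
    (hAA' : A =ᵐ[ν] A') : W.IsCoverIndicator ν P A' where
  left := h.left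
  right := hA'
  ae_eq := by
    filter_upwards [h.ae_eq, Measure.quasiMeasurePreserving_fst.ae hAA'.mem_iff,
      Measure.quasiMeasurePreserving_snd.ae hAA'.mem_iff] with z hz hfst hsnd
    rw [hz]
    exact indicator_const_eq_indicator_const <| by
      simp only [coveredPairs, mem_ofPred_eq, hfst, hsnd]

theorem isomorphic [SFinite ν] (hW : W.IsCoverIndicator ν P A) (hU : U.IsCoverIndicator ν P' A')
    {φ : α ≃ᵐ α} (hφ : MeasurePreserving φ ν ν) (hP : P =ᵐ[ν] φ ⁻¹' P')
    (hA : A =ᵐ[ν] φ ⁻¹' A') : W.Isomorphic U ν := by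
  refine ⟨φ, hφ, ?_⟩
  filter_upwards [hW.ae_eq, (hφ.prod hφ).quasiMeasurePreserving.ae hU.ae_eq,
    Measure.quasiMeasurePreserving_fst.ae hP.mem_iff,
    Measure.quasiMeasurePreserving_snd.ae hP.mem_iff,
    Measure.quasiMeasurePreserving_fst.ae hA.mem_iff,
    Measure.quasiMeasurePreserving_snd.ae hA.mem_iff] with z hWz hUz hP₁ hP₂ hA₁ hA₂
  refine hWz.trans <| (indicator_const_eq_indicator_const ?_).trans hUz.symm
  simp only [coveredPairs, mem_ofPred_eq, hP₁, hP₂, hA₁, hA₂, mem_preimage, Prod.map]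

end IsCoverIndicator

theorem IsPsi.exists_isCoverIndicator (h : U.IsPsi ν e) :
    ∃ B, ν.real B = 1 - √(1 - e) ∧ U.IsCoverIndicator ν B B := by
  obtain ⟨B, hB, hνB, hzero, hone⟩ := h
  refine ⟨B, hνB, hB, hB, .of_forall fun z => ?_⟩
  by_cases hz : z.1 ∉ B ∧ z.2 ∉ B
  · simp [hzero _ _ hz, coveredPairs, hz]
  · rw [hone _ _ hz, indicator_of_mem (by simp only [coveredPairs, mem_ofPred_eq]; tauto),
      Pi.one_apply]

theorem IsPhi.exists_isCoverIndicator (h : U.IsPhi ν e) :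
    ∃ C, ν.real C = √e ∧ U.IsCoverIndicator ν C ∅ := by
  obtain ⟨C, hC, hνC, hone, hzero⟩ := h
  refine ⟨C, hνC, hC, .empty, .of_forall fun z => ?_⟩
  by_cases hz : z.1 ∈ C ∧ z.2 ∈ C
  · simp [hone _ _ hz, coveredPairs, hz]
  · rw [hzero _ _ hz, indicator_of_notMem]
    simpa [coveredPairs] using hz

theorem IsPsi.fracCoverRatio_le [IsFiniteMeasure ν] (h : U.IsPsi ν e) :
    U.fracCoverRatio ν ≤ 1 - √(1 - e) := by
  obtain ⟨B, hνB, hB⟩ := h.exists_isCoverIndicator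
  linarith [hB.isBipartiteCover.two_mul_fracCoverRatio_le]

theorem IsPhi.fracCoverRatio_le [IsFiniteMeasure ν] (h : U.IsPhi ν e) :
    U.fracCoverRatio ν ≤ √(e / 4) := by
  obtain ⟨C, hνC, hC⟩ := h.exists_isCoverIndicator
  have hle := hC.isBipartiteCover.two_mul_fracCoverRatio_le
  rw [measureReal_empty, hνC] at hle
  rw [sqrt_div_four]
  linarith

theorem Isomorphic.fracCoverRatio_le [IsFiniteMeasure ν] (h : W.Isomorphic U ν) :
    W.fracCoverRatio ν ≤ U.fracCoverRatio ν := by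
  obtain ⟨φ, hφ, hWU⟩ := h
  obtain ⟨P, A, hPA, -, heq⟩ := U.exists_isBipartiteCover_eq ν
  have hle := (hPA.preimage hφ hWU).two_mul_fracCoverRatio_le
  rw [hφ.measureReal_preimage hPA.left.nullMeasurableSet,
    hφ.measureReal_preimage hPA.right.nullMeasurableSet] at hle
  linarith

section Uniqueness

variable [StandardBorelSpace α] [IsProbabilityMeasure ν] [NullSingletonClass ν] {B C : Set α}

theorem IsPsi.isomorphic (hU : U.IsPsi ν e) (hW : W.IsCoverIndicator ν B B)
    (hB : ν.real B = 1 - √(1 - e)) : W.Isomorphic U ν := by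
  obtain ⟨B', hB', hU⟩ := hU.exists_isCoverIndicator
  obtain ⟨φ, hφ, hBB'⟩ :=
    exists_measurableEquiv_measurePreserving ν ν hW.left hU.left (hB.trans hB'.symm)
  exact hW.isomorphic hU hφ hBB' hBB'

theorem IsPhi.isomorphic (hU : U.IsPhi ν e) (hW : W.IsCoverIndicator ν C ∅)
    (hC : ν.real C = √e) : W.Isomorphic U ν := by
  obtain ⟨C', hC', hU⟩ := hU.exists_isCoverIndicator
  obtain ⟨φ, hφ, hCC'⟩ :=
    exists_measurableEquiv_measurePreserving ν ν hW.left hU.left (hC.trans hC'.symm)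
  exact hW.isomorphic hU hφ hCC' .rfl

end Uniqueness

variable [IsProbabilityMeasure ν]

theorem fracCoverRatio_mem_Icc (W : Graphon α) : W.fracCoverRatio ν ∈ Icc (0 : ℝ) 1 := by
  obtain ⟨P, A, -, -, heq⟩ := W.exists_isBipartiteCover_eq ν
  constructor
  · linarith [measureReal_nonneg (μ := ν) (s := P), measureReal_nonneg (μ := ν) (s := A)]
  · linarith [measureReal_le_one (μ := ν) (s := P), measureReal_le_one (μ := ν) (s := A)]

theorem min_le_fracCoverRatio (W : Graphon α) :
    min √(W.edgeDensity ν / 4) (1 - √(1 - W.edgeDensity ν)) ≤ W.fracCoverRatio ν := by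
  obtain ⟨P, A, h, hAP, heq⟩ := W.exists_isBipartiteCover_eq ν
  obtain ⟨hτ0, hτ1⟩ := W.fracCoverRatio_mem_Icc (ν := ν)
  rw [min_sqrt_le_iff hτ0 hτ1 W.edgeDensity_mem_Icc.2]
  exact (h.edgeDensity_le hAP).trans <|
    sq_add_two_mul_le_max measureReal_nonneg (measureReal_mono hAP) (by linarith)

theorem exists_isCoverIndicator_eq_or_eq_zero
    (hW : W.fracCoverRatio ν = min √(W.edgeDensity ν / 4) (1 - √(1 - W.edgeDensity ν))) :
    ∃ P A, W.IsCoverIndicator ν P A ∧ A ⊆ P ∧ ν.real P + ν.real A = 2 * W.fracCoverRatio ν ∧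
      W.edgeDensity ν = ν.real P ^ 2 + 2 * ν.real A * (1 - ν.real P) ∧
      (ν.real A = ν.real P ∨ ν.real A = 0) := by
  obtain ⟨P, A, h, hAP, hPA⟩ := W.exists_isBipartiteCover_eq ν
  obtain ⟨hτ0, hτ1⟩ := W.fracCoverRatio_mem_Icc (ν := ν)
  obtain ⟨he0, he1⟩ := W.edgeDensity_mem_Icc (ν := ν)
  have hτ : 2 * W.fracCoverRatio ν = ν.real A + ν.real P := by linarith
  have hνAP : ν.real A ≤ ν.real P := measureReal_mono hAP
  have he_max := (eq_min_sqrt_iff hτ0 hτ1 he0 he1).1 hW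
  have he_le := h.edgeDensity_le hAP
  have he := he_le.antisymm <|
    (sq_add_two_mul_le_max measureReal_nonneg hνAP hτ).trans_eq he_max.symm
  exact ⟨P, A, h.isCoverIndicator hAP he, hAP, hPA, he,
    eq_or_eq_zero_of_max_le measureReal_nonneg hνAP hτ (he_max ▸ he_le)⟩

theorem exists_isCoverIndicator_of_fracCoverRatio_eq
    (hW : W.fracCoverRatio ν = min √(W.edgeDensity ν / 4) (1 - √(1 - W.edgeDensity ν))) :
    (W.edgeDensity ν ≤ 0.64 ∧
      ∃ B, ν.real B = 1 - √(1 - W.edgeDensity ν) ∧ W.IsCoverIndicator ν B B) ∨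
    (0.64 ≤ W.edgeDensity ν ∧
      ∃ C, ν.real C = √(W.edgeDensity ν) ∧ W.IsCoverIndicator ν C ∅) := by
  obtain ⟨P, A, h, hAP, hPA, he, hcases⟩ := exists_isCoverIndicator_eq_or_eq_zero hW
  have he1 := W.edgeDensity_mem_Icc (ν := ν).2
  by_cases heq : ν.real A = ν.real P
  · have hνP : ν.real P = 1 - √(1 - W.edgeDensity ν) := by
      rw [show 1 - W.edgeDensity ν = (1 - ν.real P) ^ 2 by rw [he, heq]; ring,
        Real.sqrt_sq (sub_nonneg.2 measureReal_le_one), sub_sub_cancel]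
    have hAP_ae : A =ᵐ[ν] P := ae_eq_of_subset_of_measure_ge hAP
      ((measureReal_eq_measureReal_iff).1 heq).ge h.right.nullMeasurableSet (measure_ne_top _ _)
    refine .inl ⟨(one_sub_sqrt_le_sqrt_iff he1).1 ?_, P, hνP, h.congr_right h.left hAP_ae⟩
    rw [← hνP, show ν.real P = W.fracCoverRatio ν by linarith, hW]
    exact min_le_left _ _
  · have hA : ν.real A = 0 := hcases.resolve_left heq
    have hP : ν.real P ≠ 0 := fun hP => heq (hA.trans hP.symm)
    have he_sq : W.edgeDensity ν = ν.real P ^ 2 := by rw [he, hA]; ring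
    have he_pos : 0 < W.edgeDensity ν := he_sq ▸ pow_pos (measureReal_nonneg.lt_of_ne' hP) 2
    have hνP : ν.real P = √(W.edgeDensity ν) := by rw [he_sq, Real.sqrt_sq measureReal_nonneg]
    have hA_ae : A =ᵐ[ν] (∅ : Set α) := ae_eq_empty.2 ((measureReal_eq_zero_iff).1 hA)
    refine .inr ⟨(sqrt_le_one_sub_sqrt_iff he_pos he1).1 ?_, P, hνP, h.congr_right .empty hA_ae⟩
    rw [sqrt_div_four, ← hνP, show ν.real P / 2 = W.fracCoverRatio ν by linarith, hW]
    exact min_le_right _ _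

end Graphon

end

theorem mainTheorem5 {Ω : Type*} [MeasurableSpace Ω] [StandardBorelSpace Ω]
    (ν : Measure Ω) [IsProbabilityMeasure ν] [NullSingletonClass ν]
    (W : Graphon Ω) (e : ℝ) (he : e = W.edgeDensity ν) :
    -- the lower bound
    min √(e / 4) (1 - √(1 - e)) ≤ W.fracCoverRatio ν ∧
    -- the transition at edge density 0.64
    (e ≤ 0.64 → min √(e / 4) (1 - √(1 - e)) = 1 - √(1 - e)) ∧
    (0.64 ≤ e → min √(e / 4) (1 - √(1 - e)) = √(e / 4)) ∧
    -- the extremal graphons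
    (∃ Ψ : Graphon Ω, Ψ.IsPsi ν e) ∧ (∃ Φ : Graphon Ω, Φ.IsPhi ν e) ∧
    ∀ Ψ Φ : Graphon Ω, Ψ.IsPsi ν e → Φ.IsPhi ν e →
      (W.fracCoverRatio ν = min √(e / 4) (1 - √(1 - e)) ↔
        (e ≤ 0.64 ∧ W.Isomorphic Ψ ν) ∨ (0.64 ≤ e ∧ W.Isomorphic Φ ν)) := by
  subst he
  obtain ⟨he0, he1⟩ := W.edgeDensity_mem_Icc (ν := ν)
  have hmin_le := W.min_le_fracCoverRatio (ν := ν)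
  have hmin_right (he : W.edgeDensity ν ≤ 0.64) :=
    min_eq_right ((one_sub_sqrt_le_sqrt_iff he1).2 he)
  have hmin_left (he : 0.64 ≤ W.edgeDensity ν) :=
    min_eq_left ((sqrt_le_one_sub_sqrt_iff (by linarith) he1).2 he)
  refine ⟨hmin_le, hmin_right, hmin_left, Graphon.exists_isPsi ν ⟨he0, he1⟩,
    Graphon.exists_isPhi ν ⟨he0, he1⟩, fun Ψ Φ hΨ hΦ => ⟨fun hτ => ?_, ?_⟩⟩
  · rcases Graphon.exists_isCoverIndicator_of_fracCoverRatio_eq hτ with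
      ⟨he, B, hνB, hB⟩ | ⟨he, C, hνC, hC⟩
    · exact .inl ⟨he, hΨ.isomorphic hB hνB⟩
    · exact .inr ⟨he, hΦ.isomorphic hC hνC⟩
  · rintro (⟨he, hWΨ⟩ | ⟨he, hWΦ⟩)
    · exact (hWΨ.fracCoverRatio_le.trans hΨ.fracCoverRatio_le |>.trans_eq
        (hmin_right he).symm).antisymm hmin_le
    · exact (hWΦ.fracCoverRatio_le.trans hΦ.fracCoverRatio_le |>.trans_eq
        (hmin_left he).symm).antisymm hmin_le
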